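/- Let $G$ be a compact group with normalized Haar measure $dg$ and let $\widehat G$ be the set of equivalence classes of its irreducible (continuous, hence finite-dimensional) unitary representations, $d_a$ being the dimension of $a\in\widehat G$ and $\bar a$ its conjugate. Let $R_1,R_2$ be two complete, in general non-ideal, frames: for $i=1,2$, $R_i$ is a finite-dimensional Hilbert space $\mathcal H_{R_i}$ of dimension $d_{R_i}$ with a continuous unitary representation $U_{R_i}$ of $G$ and a unit seed vector $\phi_i$ such that $d_{R_i}\int_G U_{R_i}(g)|\phi_i\rangle\langle\phi_i|U_{R_i}(g)^\dagger\,dg=\mathbf 1$ and such that $U_{R_i}(g)\phi_i=\phi_i$ only for $g=e$. Let $S$ be a finite-dimensional Hilbert space $\mathcal H_S$ with a continuous unitary representation $U_S$ of $G$. Let $\psi\in\mathcal H_{R_1}\otimes\mathcal H_{R_2}\otimes\mathcal H_S$ be a unit vector with $(U_{R_1}(g)\otimes U_{R_2}(g)\otimes U_S(g))\psi=\psi$ for all $g\in G$. Let $\rho^{(R_i)}=d_{R_i}\,\langle\phi_i|_{R_i}\,|\psi\rangle\langle\psi|\,|\phi_i\rangle_{R_i}$ be the relational state of the other frame $R_j$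 ($j\ne i$) and $S$ in the perspective of $R_i$, with reduced states $\rho^{(R_i)}_S=\operatorname{Tr}_{R_j}\rho^{(R_i)}$ and $\rho^{(R_i)}_{R_j}=\operatorname{Tr}_S\rho^{(R_i)}$. For a representation $X$ let $m_a^X$ be the multiplicity of $a\in\widehat G$ in $X$, let $N_{bc}^{\,q}$ be the multiplicity of $q$ in $b\otimes c$, and for $i\neq j\in\{1,2\}$ put $$d_{\mathrm{eff}}(R_i|R_j)=\sum_{a\in\widehat G} d_a\,\min\Bigl(m_a^{R_i},\ \sum_{b,c\in\widehat G} m_b^{R_j}\,m_c^{S}\,N_{bc}^{\,\bar a}\Bigr).$$ For $\alpha>0$ let $S_\alpha(\rho)=\frac1{1-\alpha}\log\operatorname{Tr}(\rho^\alpha)$ if $\alpha\ne1$ and $S_1(\rho)=-\operatorname{Tr}(\rho\log\rho)$. Then $\operatorname{rank}\rho^{(R_1)}_{R_2}\le d_{\mathrm{eff}}(R_2|R_1)$ and $\operatorname{rank}\rho^{(R_2)}_{R_1}\le d_{\mathrm{eff}}(R_1|R_2)$, and for every $\alpha>0$ $$\bigl|S_\alpha(\rho^{(R_1)}_S)-S_\alpha(\rho^{(R_2)}_S)\bigr|\le\log\max\{d_{\mathrm{eff}}(R_1|R_2),\,d_{\mathrm{eff}}(R_2|R_1)\}.$$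 -/

import Mathlib

open scoped TensorProduct

noncomputable section

namespace QRF

/-- A (strongly continuous) unitary representation of the topological group `G` on `H`. -/
structure UnitaryRep (G : Type*) [Group G] [TopologicalSpace G]
    (H : Type*) [NormedAddCommGroup H] [InnerProductSpace ℂ H] where
  /-- the underlying linear representation -/
  rep : Representation ℂ G H
  inner_map : ∀ (g : G) (x y : H), inner ℂ (rep g x) (rep g y) = inner ℂ x y
  continuous_orbit : ∀ x : H, Continuous fun g : G => rep g x

/-! ### Irreducible representations, multiplicities -/

/-- Finite-dimensional irreducible unitary representations of `G`, realised on some `ℂⁿ`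
(for a compact group every irreducible unitary representation is of this form up to
equivalence). -/
structure IrrepModel (G : Type*) [Group G] [TopologicalSpace G] where
  /-- the dimension -/
  dim : ℕ
  /-- the representation -/
  toUnitaryRep : UnitaryRep G (EuclideanSpace ℂ (Fin dim))
  irreducible : toUnitaryRep.rep.IsIrreducible

/-- Equivalence of irreducible representations. -/
instance irrepSetoid (G : Type*) [Group G] [TopologicalSpace G] : Setoid (IrrepModel G) where
  r D E := Nonempty (D.toUnitaryRep.rep.Equiv E.toUnitaryRep.rep)
  iseqv :=
    { refl := fun D => ⟨Representation.Equiv.refl D.toUnitaryRep.rep⟩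
      symm := fun ⟨e⟩ => ⟨e.symm⟩
      trans := fun ⟨e⟩ ⟨f⟩ => ⟨e.trans f⟩ }

/-- The unitary dual `Ĝ`: equivalence classes of irreducible unitary representations. -/
def UnitaryDual (G : Type*) [Group G] [TopologicalSpace G] : Type _ :=
  Quotient (irrepSetoid G)

/-- The dimension `d_a` of the irrep `a`. -/
def UnitaryDual.dim {G : Type*} [Group G] [TopologicalSpace G] (a : UnitaryDual G) : ℕ :=
  (Quotient.out a).dim

/-- A representation `D_a` in the class `a`. -/
def UnitaryDual.rep {G : Type*} [Group G] [TopologicalSpace G] (a : UnitaryDual G) :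
    Representation ℂ G (EuclideanSpace ℂ (Fin a.dim)) :=
  (Quotient.out a).toUnitaryRep.rep

/-- The multiplicity `dim Hom_G(σ, ρ)` of an irreducible representation `σ` in `ρ`. -/
def repMultiplicity {G V W : Type*} [Group G] [AddCommGroup V] [Module ℂ V]
    [AddCommGroup W] [Module ℂ W]
    (σ : Representation ℂ G V) (ρ : Representation ℂ G W) : ℕ :=
  Module.finrank ℂ (Representation.IntertwiningMap σ ρ)

/-- The multiplicity `m_a` of the irrep `a` in the unitary representation `U`. -/
def irrepMult {G : Type*} [Group G] [TopologicalSpace G]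
    {H : Type*} [NormedAddCommGroup H] [InnerProductSpace ℂ H]
    (a : UnitaryDual G) (U : UnitaryRep G H) : ℕ :=
  repMultiplicity a.rep U.rep

/-- The Clebsch–Gordan multiplicity `N_{bc}^{ā}` of the conjugate (= dual) `ā` of the irrep `a`
in the tensor product of the irreps `b` and `c`. -/
def clebschGordanConj {G : Type*} [Group G] [TopologicalSpace G]
    (b c a : UnitaryDual G) : ℕ :=
  repMultiplicity a.rep.dual (b.rep.tprod c.rep)

/-- `d_eff(R | R') = ∑_a d_a min(m_a^R, ∑_{b,c} m_b^{R'} m_c^S N_{bc}^{ā})`, for representations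
`U`, `U'`, `V` carried by `R`, `R'`, `S`.  On finite-dimensional spaces only finitely many irreps
have non-zero multiplicity, so both sums have finite support. -/
def dEff {G : Type*} [Group G] [TopologicalSpace G]
    {H H' K : Type*} [NormedAddCommGroup H] [InnerProductSpace ℂ H]
    [NormedAddCommGroup H'] [InnerProductSpace ℂ H']
    [NormedAddCommGroup K] [InnerProductSpace ℂ K]
    (U : UnitaryRep G H) (U' : UnitaryRep G H') (V : UnitaryRep G K) : ℕ :=
  ∑ᶠ a : UnitaryDual G, a.dim * min (irrepMult a U)
    (∑ᶠ p : UnitaryDual G × UnitaryDual G,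
      irrepMult p.1 U' * irrepMult p.2 V * clebschGordanConj p.1 p.2 a)

/-! ### Frames -/

/-- A complete (in general non-ideal) quantum reference frame: a unitary representation with a
normalized seed state `φ` whose coherent states `φ(g) = U(g) φ` resolve the identity,
`d ∫ |φ(g)⟩⟨φ(g)| dg = 1` (the constant has to be `d = dim H`, by taking traces), and label the
group elements faithfully, i.e. the seed has trivial stabilizer. -/
structure CompleteFrame (G : Type*) [Group G] [TopologicalSpace G] [MeasurableSpace G]
    (μ : MeasureTheory.Measure G)
    (H : Type*) [NormedAddCommGroup H] [InnerProductSpace ℂ H] extends UnitaryRep G H where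
  /-- the seed state `|φ⟩` -/
  seed : H
  norm_seed : ‖seed‖ = 1
  resolution_identity : ∀ v : H,
    (Module.finrank ℂ H : ℂ) • ∫ g, (inner ℂ (rep g seed) v : ℂ) • rep g seed ∂μ = v
  complete : ∀ g : G, rep g seed = seed → g = 1

/-! ### Operators on tensor products -/

section Operators

variable {A B : Type*} [NormedAddCommGroup A] [InnerProductSpace ℂ A]
  [NormedAddCommGroup B] [InnerProductSpace ℂ B]

/-- The pure state `|ψ⟩⟨ψ|`, i.e. `x ↦ ⟨ψ, x⟩ ψ`. -/
def ketBra (ψ : A) : A →ₗ[ℂ] A := (innerₛₗ ℂ ψ).smulRight ψ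

/-- `⟨φ| ⊗ 1 : A ⊗ B → B`. -/
def braLeft (B : Type*) [NormedAddCommGroup B] [InnerProductSpace ℂ B] (φ : A) :
    A ⊗[ℂ] B →ₗ[ℂ] B :=
  (TensorProduct.lid ℂ B).toLinearMap ∘ₗ LinearMap.rTensor B (innerₛₗ ℂ φ)

/-- `1 ⊗ ⟨φ| : A ⊗ B → A`. -/
def braRight (A : Type*) [NormedAddCommGroup A] [InnerProductSpace ℂ A] (φ : B) :
    A ⊗[ℂ] B →ₗ[ℂ] A :=
  (TensorProduct.rid ℂ A).toLinearMap ∘ₗ LinearMap.lTensor A (innerₛₗ ℂ φ)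

variable [FiniteDimensional ℂ A] [FiniteDimensional ℂ B]

/-- Partial trace over the left factor, `Tr_A T = ∑ᵢ (⟨eᵢ| ⊗ 1) T (|eᵢ⟩ ⊗ 1)`. -/
def traceLeft (T : A ⊗[ℂ] B →ₗ[ℂ] A ⊗[ℂ] B) : B →ₗ[ℂ] B :=
  ∑ i, braLeft B (stdOrthonormalBasis ℂ A i) ∘ₗ T ∘ₗ
    TensorProduct.mk ℂ A B (stdOrthonormalBasis ℂ A i)

/-- Partial trace over the right factor, `Tr_B T = ∑ᵢ (1 ⊗ ⟨eᵢ|) T (1 ⊗ |eᵢ⟩)`. -/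
def traceRight (T : A ⊗[ℂ] B →ₗ[ℂ] A ⊗[ℂ] B) : A →ₗ[ℂ] A :=
  ∑ i, braRight A (stdOrthonormalBasis ℂ B i) ∘ₗ T ∘ₗ
    (TensorProduct.mk ℂ A B).flip (stdOrthonormalBasis ℂ B i)

/-- The eigenvalues of an operator, with multiplicity; the real part is taken
since the states of interest are self-adjoint. -/
def eigenvalueMultiset (ρ : A →ₗ[ℂ] A) : Multiset ℝ :=
  ρ.charpoly.roots.map Complex.re

/-- The Rényi entropy `S_α(ρ) = log (Tr ρ^α) / (1 - α)` of a density operator, which for `α = 1`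
is the von Neumann entropy `- Tr (ρ log ρ)`. -/
def renyiEntropy (α : ℝ) (ρ : A →ₗ[ℂ] A) : ℝ :=
  if α = 1 then ((eigenvalueMultiset ρ).map Real.negMulLog).sum
  else 1 / (1 - α) * Real.log ((eigenvalueMultiset ρ).map fun x => x ^ α).sum

end Operators

/-! ### Two frames and a system -/

section TwoFrames

variable {G : Type*} [Group G] [TopologicalSpace G] [MeasurableSpace G]
  {μ : MeasureTheory.Measure G}
  {H₁ H₂ K : Type*} [NormedAddCommGroup H₁] [InnerProductSpace ℂ H₁]
  [NormedAddCommGroup H₂] [InnerProductSpace ℂ H₂]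
  [NormedAddCommGroup K] [InnerProductSpace ℂ K]

/-- `ψ` is a physical state: a unit vector of `H_{R₁} ⊗ H_{R₂} ⊗ H_S` that is invariant under
the diagonal action `U_{R₁}(g) ⊗ U_{R₂}(g) ⊗ U_S(g)`. -/
def IsPhysicalState (U₁ : UnitaryRep G H₁) (U₂ : UnitaryRep G H₂) (V : UnitaryRep G K)
    (ψ : H₁ ⊗[ℂ] (H₂ ⊗[ℂ] K)) : Prop :=
  ‖ψ‖ = 1 ∧ ∀ g : G, (U₁.rep.tprod (U₂.rep.tprod V.rep)) g ψ = ψ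

/-- The conditioning map `⟨φ|_{R₁} ⊗ 1_{R₂ S}`. -/
def bra₁ (φ : H₁) : H₁ ⊗[ℂ] (H₂ ⊗[ℂ] K) →ₗ[ℂ] H₂ ⊗[ℂ] K := braLeft (H₂ ⊗[ℂ] K) φ

/-- The conditioning map `⟨φ|_{R₂} ⊗ 1_{R₁ S}`. -/
def bra₂ (φ : H₂) : H₁ ⊗[ℂ] (H₂ ⊗[ℂ] K) →ₗ[ℂ] H₁ ⊗[ℂ] K :=
  LinearMap.lTensor H₁ (braLeft K φ)

variable [FiniteDimensional ℂ H₁] [FiniteDimensional ℂ H₂] [FiniteDimensional ℂ K]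

/-- The relational state `d_{R₁} ⟨φ₁|ψ⟩⟨ψ|φ₁⟩` of `R₂ S` in the perspective of `R₁`. -/
def relState₁ (R₁ : CompleteFrame G μ H₁) (ψ : H₁ ⊗[ℂ] (H₂ ⊗[ℂ] K)) :
    H₂ ⊗[ℂ] K →ₗ[ℂ] H₂ ⊗[ℂ] K :=
  (Module.finrank ℂ H₁ : ℂ) •
    (bra₁ R₁.seed ∘ₗ ketBra ψ ∘ₗ LinearMap.adjoint (bra₁ R₁.seed))

/-- The relational state `d_{R₂} ⟨φ₂|ψ⟩⟨ψ|φ₂⟩` of `R₁ S` in the perspective of `R₂`. -/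
def relState₂ (R₂ : CompleteFrame G μ H₂) (ψ : H₁ ⊗[ℂ] (H₂ ⊗[ℂ] K)) :
    H₁ ⊗[ℂ] K →ₗ[ℂ] H₁ ⊗[ℂ] K :=
  (Module.finrank ℂ H₂ : ℂ) •
    (bra₂ R₂.seed ∘ₗ ketBra ψ ∘ₗ LinearMap.adjoint (bra₂ R₂.seed))

/-- The difference `|S_α(ρ_S^{(R₁)}) - S_α(ρ_S^{(R₂)})|` of the Rényi entropies that the two frames
assign to `S`, where `ρ_S^{(Rᵢ)}` is the relational state with the other frame traced out. -/
def entropyDifference (α : ℝ) (R₁ : CompleteFrame G μ H₁) (R₂ : CompleteFrame G μ H₂)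
    (ψ : H₁ ⊗[ℂ] (H₂ ⊗[ℂ] K)) : ℝ :=
  |renyiEntropy α (traceLeft (relState₁ R₁ ψ)) - renyiEntropy α (traceLeft (relState₂ R₂ ψ))|

end TwoFrames

end QRF

end

/-! Regard the physical state as a tensor in `R₂ ⊗ (R₁ ⊗ S)`, and let `W ⊆ R₂` be its support, the
set of its contractions with all functionals on `R₁ ⊗ S`. Invariance of the state makes `W` a
subrepresentation, and the state embeds the dual of `W` equivariantly in `R₁ ⊗ S`. An irrep `a` thus
occurs in `W` at most `m_a^{R₂}` times, and at most as often as its conjugate occurs in `R₁ ⊗ S`,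
which is at most the Clebsch–Gordan sum. Hence `dim W ≤ d_eff(R₂|R₁)`
(`finrank_range_contractRight_le`, `repMultiplicity_tprod_le`).

Conditioning on the seed of `R₁` only restricts the functionals used, so the support on `R₂` of the
conditioned vector stays inside `W`. The relational state is pure, and both its marginals, on `R₂`
and on `S`, have rank at most its Schmidt rank, hence at most `d_eff(R₂|R₁)`.

The resolution of the identity and invariance give the relational state trace one
(`CompleteFrame.finrank_mul_inner_braLeft`), so the Rényi entropies on `S` lie between zero and the
logarithm of the rank. With the frames exchanged, both entropies lie in `[0, log max]`, and so their
difference is at most `log max`. -/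

noncomputable section

namespace QRF

open Representation

/-! ### Complete reducibility of finite-dimensional unitary representations. -/

section Decomposition

variable {G : Type*} [Group G] [TopologicalSpace G]

namespace UnitaryRep

variable {H : Type*} [NormedAddCommGroup H] [InnerProductSpace ℂ H]

lemma rep_apply_inv (U : UnitaryRep G H) (g : G) (x : H) : U.rep g (U.rep g⁻¹ x) = x := by
  rw [← Module.End.mul_apply, ← map_mul, mul_inv_cancel, map_one, Module.End.one_apply]

lemma inner_rep_left (U : UnitaryRep G H) (g : G) (x y : H) :
    inner ℂ (U.rep g x) y = inner ℂ x (U.rep g⁻¹ y) := by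
  conv_lhs => rw [← U.rep_apply_inv g y, U.inner_map]

/-- The action of a group element as a linear isometry. -/
def isometry (U : UnitaryRep G H) (g : G) : H →ₗᵢ[ℂ] H :=
  (U.rep g).isometryOfInner (U.inner_map g)

/-- The restriction of a unitary representation to an invariant subspace. -/
def restrict (U : UnitaryRep G H) (N : Subrepresentation U.rep) : UnitaryRep G N.toSubmodule where
  rep := N.toRepresentation
  inner_map g x y := U.inner_map g x y
  continuous_orbit x := Continuous.subtype_mk (U.continuous_orbit x) _

/-- The orthogonal complement of an invariant subspace. -/
def orthogonal (U : UnitaryRep G H) (N : Subrepresentation U.rep) : Subrepresentation U.rep where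
  toSubmodule := N.toSubmoduleᗮ
  apply_mem_toSubmodule g v hv := by
    rw [Submodule.mem_orthogonal'] at hv ⊢
    intro u hu
    rw [U.inner_rep_left]
    exact hv _ (N.apply_mem_toSubmodule _ hu)

/-- The inclusion of an invariant subspace. -/
def inclusion (U : UnitaryRep G H) (N : Subrepresentation U.rep) :
    IntertwiningMap (U.restrict N).rep U.rep :=
  LinearMap.intertwiningMap_of_isIntertwiningMap _ _ N.toSubmodule.subtype fun _ _ => rfl

lemma inclusion_apply (U : UnitaryRep G H) (N : Subrepresentation U.rep) (x : N.toSubmodule) :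
    U.inclusion N x = (x : H) := rfl

variable [FiniteDimensional ℂ H]

/-- The orthogonal projection onto an invariant subspace. -/
def projection (U : UnitaryRep G H) (N : Subrepresentation U.rep) :
    IntertwiningMap U.rep (U.restrict N).rep :=
  LinearMap.intertwiningMap_of_isIntertwiningMap _ _
    (N.toSubmodule.orthogonalProjectionOnto : H →ₗ[ℂ] N.toSubmodule) fun g v => by
      apply Subtype.ext
      -- The action preserves both the subspace and its orthogonal complement, hence the splitting
      -- of `v`.
      have h : N.toSubmodule.starProjection (U.rep g v) = U.rep g (N.toSubmodule.starProjection v) := by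
        apply Submodule.eq_starProjection_of_mem_orthogonal
        · exact N.apply_mem_toSubmodule g (Submodule.starProjection_apply_mem _ v)
        · rw [← map_sub]
          exact (U.orthogonal N).apply_mem_toSubmodule g
            (Submodule.sub_starProjection_mem_orthogonal v)
      exact h

lemma coe_projection_apply (U : UnitaryRep G H) (N : Subrepresentation U.rep) (x : H) :
    (U.projection N x : H) = N.toSubmodule.starProjection x := rfl

lemma projection_inclusion (U : UnitaryRep G H) (N : Subrepresentation U.rep)
    (x : N.toSubmodule) : U.projection N (U.inclusion N x) = x :=
  Submodule.orthogonalProjectionOnto_mem_subspace_eq_self x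

end UnitaryRep

/-- A decomposition of a representation as a finite direct sum of irreducible ones, given by the
inclusions of and the projections to the summands. -/
structure IrrepDecomposition {V : Type*} [AddCommGroup V] [Module ℂ V]
    (ρ : Representation ℂ G V) where
  /-- the labels of the summands -/
  ι : Type
  [fintype : Fintype ι]
  /-- the summands -/
  irrep : ι → UnitaryDual G
  /-- the inclusions -/
  incl : ∀ i, IntertwiningMap (irrep i).rep ρ
  /-- the projections -/
  proj : ∀ i, IntertwiningMap ρ (irrep i).rep
  proj_incl_self : ∀ i x, proj i (incl i x) = x
  proj_incl_ne : ∀ i j, i ≠ j → ∀ x, proj i (incl j x) = 0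
  sum_incl_proj : ∀ v, ∑ i, incl i (proj i v) = v

attribute [instance] IrrepDecomposition.fintype

lemma UnitaryDual.isIrreducible (a : UnitaryDual G) : a.rep.IsIrreducible :=
  (Quotient.out a).irreducible

omit [TopologicalSpace G] in
lemma isIrreducible_of_equiv {V W : Type*} [AddCommGroup V] [Module ℂ V] [AddCommGroup W]
    [Module ℂ W] {ρ : Representation ℂ G V} {σ : Representation ℂ G W} (e : ρ.Equiv σ)
    (h : ρ.IsIrreducible) : σ.IsIrreducible := by
  rw [irreducible_iff_isSimpleModule_asModule] at h ⊢
  let f := IntertwiningMap.equivLinearMapAsModule ρ σ e.toIntertwiningMap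
  have hf : Function.Bijective f := e.toLinearEquiv.bijective
  exact IsSimpleModule.congr (LinearEquiv.ofBijective f hf).symm

/-- An irreducible unitary representation on a finite-dimensional space is equivalent to the
representative of some class in the unitary dual. -/
lemma exists_unitaryDual_equiv {H : Type*} [NormedAddCommGroup H] [InnerProductSpace ℂ H]
    [FiniteDimensional ℂ H] (U : UnitaryRep G H) (hU : U.rep.IsIrreducible) :
    ∃ a : UnitaryDual G, Nonempty (a.rep.Equiv U.rep) := by
  let e : H ≃ₗᵢ[ℂ] EuclideanSpace ℂ (Fin (Module.finrank ℂ H)) := (stdOrthonormalBasis ℂ H).repr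
  let V : UnitaryRep G (EuclideanSpace ℂ (Fin (Module.finrank ℂ H))) :=
    { rep :=
        { toFun := fun g => e.toLinearEquiv.toLinearMap ∘ₗ U.rep g ∘ₗ e.symm.toLinearEquiv.toLinearMap
          map_one' := by ext; simp
          map_mul' := fun g h => by ext; simp }
      inner_map := fun g x y => by
        change inner ℂ (e (U.rep g (e.symm x))) (e (U.rep g (e.symm y))) = _
        rw [e.inner_map_map, U.inner_map, e.symm.inner_map_map]
      continuous_orbit := fun x => e.continuous.comp (U.continuous_orbit (e.symm x)) }
  let E : U.rep.Equiv V.rep := Representation.Equiv.mk e.toLinearEquiv fun g => by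
    refine LinearMap.ext fun x => ?_
    change e (U.rep g x) = e (U.rep g (e.symm (e x)))
    rw [e.symm_apply_apply]
  let D : IrrepModel G := ⟨_, V, isIrreducible_of_equiv E hU⟩
  -- The representative chosen by `Quotient.out` need not be `D` itself, only equivalent to it.
  obtain ⟨F⟩ : Nonempty ((Quotient.out (⟦D⟧ : UnitaryDual G)).toUnitaryRep.rep.Equiv V.rep) :=
    Quotient.exact (Quotient.out_eq (⟦D⟧ : UnitaryDual G))
  exact ⟨⟦D⟧, ⟨F.trans E.symm⟩⟩

/-- A nonzero finite-dimensional representation has an irreducible subrepresentation. -/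
lemma exists_irreducible_subrepresentation {H : Type*} [NormedAddCommGroup H]
    [InnerProductSpace ℂ H] [FiniteDimensional ℂ H] [Nontrivial H] (U : UnitaryRep G H) :
    ∃ N : Subrepresentation U.rep, N.toSubmodule ≠ ⊥ ∧ (U.restrict N).rep.IsIrreducible := by
  -- A nonzero invariant subspace of least dimension is irreducible.
  obtain ⟨N, hN, hmin⟩ := (measure fun N : Subrepresentation U.rep =>
    Module.finrank ℂ N.toSubmodule).wf.has_min {N | N.toSubmodule ≠ ⊥} ⟨⊤, top_ne_bot⟩
  refine ⟨N, hN, ?_⟩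
  have : Nontrivial N.toSubmodule := (Submodule.nontrivial_iff_ne_bot).2 hN
  refine @IsSimpleOrder.mk _ _ _ ?_ ?_
  · refine ⟨⊥, ⊤, fun h => ?_⟩
    exact bot_ne_top (congrArg Subrepresentation.toSubmodule h : (⊥ : Submodule ℂ N.toSubmodule) = ⊤)
  · intro M
    let M' : Subrepresentation U.rep :=
      { toSubmodule := M.toSubmodule.map N.toSubmodule.subtype
        apply_mem_toSubmodule := by
          rintro g _ ⟨x, hx, rfl⟩
          exact ⟨_, M.apply_mem_toSubmodule g hx, rfl⟩ }
    by_cases hM : M.toSubmodule = ⊥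
    · exact Or.inl (Subrepresentation.toSubmodule_injective hM)
    · right
      have h1 : ¬ Module.finrank ℂ M'.toSubmodule < Module.finrank ℂ N.toSubmodule := by
        apply hmin M'
        refine fun h => hM ?_
        rw [Submodule.eq_bot_iff]
        intro x hx
        exact Subtype.ext ((Submodule.eq_bot_iff _).1 h _ ⟨x, hx, rfl⟩)
      have h2 : Module.finrank ℂ M'.toSubmodule = Module.finrank ℂ M.toSubmodule :=
        (Submodule.equivMapOfInjective _ N.toSubmodule.injective_subtype M.toSubmodule).finrank_eq.symm
      refine Subrepresentation.toSubmodule_injective (Submodule.eq_top_of_finrank_eq ?_)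
      exact le_antisymm (Submodule.finrank_le _) (by omega)

universe u

/-- Split off one irreducible subspace; its orthogonal complement is invariant and of smaller
dimension. The space is quantified inside the induction because it changes to that complement. -/
lemma nonempty_irrepDecomposition_of_finrank (n : ℕ) :
    ∀ (H : Type u) [NormedAddCommGroup H] [InnerProductSpace ℂ H] [FiniteDimensional ℂ H]
      (U : UnitaryRep G H), Module.finrank ℂ H = n → Nonempty (IrrepDecomposition U.rep) := by
  induction n using Nat.strong_induction_on with
  | _ n ih =>
    intro H _ _ _ U hn
    rcases subsingleton_or_nontrivial H with hH | hH
    · exact ⟨⟨Empty, Empty.elim, fun i => i.elim, fun i => i.elim, fun i => i.elim,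
        fun i => i.elim, fun v => Subsingleton.elim _ _⟩⟩
    obtain ⟨N, hN, hirr⟩ := exists_irreducible_subrepresentation U
    obtain ⟨a, ⟨e⟩⟩ := exists_unitaryDual_equiv (U.restrict N) hirr
    let P := U.orthogonal N
    have hfr : Module.finrank ℂ P.toSubmodule < n := by
      have h1 := Submodule.finrank_add_finrank_orthogonal N.toSubmodule
      have h2 : Module.finrank ℂ N.toSubmodule ≠ 0 := fun h => hN (Submodule.finrank_eq_zero.1 h)
      change Module.finrank ℂ N.toSubmoduleᗮ < n
      omega
    obtain ⟨D⟩ := ih _ hfr P.toSubmodule (U.restrict P) rfl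
    have hNP : ∀ x : P.toSubmodule, U.projection N (U.inclusion P x) = 0 := fun x => by
      apply Subtype.ext
      rw [UnitaryRep.coe_projection_apply, UnitaryRep.inclusion_apply]
      exact (Submodule.starProjection_apply_eq_zero_iff _).2 x.2
    have hPN : ∀ x : N.toSubmodule, U.projection P (U.inclusion N x) = 0 := fun x => by
      apply Subtype.ext
      rw [UnitaryRep.coe_projection_apply, UnitaryRep.inclusion_apply]
      exact (Submodule.starProjection_apply_eq_zero_iff _).2
        (Submodule.le_orthogonal_orthogonal _ x.2)
    have hsum : ∀ v, U.inclusion N (U.projection N v) + U.inclusion P (U.projection P v) = v :=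
      fun v => Submodule.starProjection_add_starProjection_orthogonal v
    refine ⟨⟨Option D.ι, fun i => i.elim a D.irrep,
      fun i => match i with
        | none => (U.inclusion N).comp e.toIntertwiningMap
        | some i => (U.inclusion P).comp (D.incl i),
      fun i => match i with
        | none => e.symm.toIntertwiningMap.comp (U.projection N)
        | some i => (D.proj i).comp (U.projection P), ?_, ?_, ?_⟩⟩
    · rintro (_ | i) x
      · change e.symm (U.projection N (U.inclusion N (e x))) = x
        rw [UnitaryRep.projection_inclusion]
        exact Representation.Equiv.symm_apply_apply e x
      · change D.proj i (U.projection P (U.inclusion P (D.incl i x))) = x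
        rw [UnitaryRep.projection_inclusion]
        exact D.proj_incl_self i x
    · rintro (_ | i) (_ | j) hij x
      · exact absurd rfl hij
      · change e.symm (U.projection N (U.inclusion P (D.incl j x))) = 0
        rw [hNP, map_zero]
      · change D.proj i (U.projection P (U.inclusion N (e x))) = 0
        rw [hPN, map_zero]
      · change D.proj i (U.projection P (U.inclusion P (D.incl j x))) = 0
        rw [UnitaryRep.projection_inclusion]
        exact D.proj_incl_ne i j (fun h => hij (by rw [h])) x
    · intro v
      rw [Fintype.sum_option]
      change U.inclusion N (e (e.symm (U.projection N v))) +
        ∑ i, U.inclusion P (D.incl i (D.proj i (U.projection P v))) = v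
      rw [← map_sum, D.sum_incl_proj, Representation.Equiv.apply_symm_apply, hsum]

/-- Finite-dimensional unitary representations are completely reducible. -/
lemma UnitaryRep.nonempty_irrepDecomposition {H : Type*} [NormedAddCommGroup H]
    [InnerProductSpace ℂ H] [FiniteDimensional ℂ H] (U : UnitaryRep G H) :
    Nonempty (IrrepDecomposition U.rep) :=
  nonempty_irrepDecomposition_of_finrank _ H U rfl

end Decomposition

/-! ### Multiplicities and Schur's lemma. -/

section Multiplicity

variable {G : Type*} [Group G] [TopologicalSpace G]

lemma UnitaryDual.eq_of_equiv {a b : UnitaryDual G} (e : a.rep.Equiv b.rep) : a = b :=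
  Quotient.out_equiv_out.1 ⟨e⟩

lemma UnitaryDual.exists_ne_zero (a : UnitaryDual G) : ∃ x : EuclideanSpace ℂ (Fin a.dim), x ≠ 0 := by
  by_contra! h
  have := a.isIrreducible
  obtain ⟨M, N, hMN⟩ := exists_pair_ne (Subrepresentation a.rep)
  refine hMN (SetLike.ext fun x => ?_)
  rw [h x]
  exact iff_of_true M.toSubmodule.zero_mem N.toSubmodule.zero_mem

namespace IrrepDecomposition

variable {V : Type*} [AddCommGroup V] [Module ℂ V] {ρ : Representation ℂ G V}
  (D : IrrepDecomposition ρ)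

/-- By Schur's lemma, `f` followed by the projection to a summand of another class vanishes; were
all summands of other classes, `f` would be zero. -/
lemma exists_irrep_eq {b : UnitaryDual G} {f : IntertwiningMap b.rep ρ} (hf : f ≠ 0) :
    ∃ i, D.irrep i = b := by
  by_contra! h
  refine hf (IntertwiningMap.ext (LinearMap.ext fun x => ?_))
  have h0 : ∀ i, (D.proj i).comp f = 0 := fun i => by
    have := (D.irrep i).isIrreducible
    have := b.isIrreducible
    refine (IsIrreducible.bijective_or_eq_zero ((D.proj i).comp f)).resolve_left fun hb => ?_
    exact h i (UnitaryDual.eq_of_equiv (IntertwiningMap.ofBijective _ hb)).symm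
  change f x = 0
  rw [← D.sum_incl_proj (f x)]
  refine Finset.sum_eq_zero fun i _ => ?_
  have : D.proj i (f x) = 0 := DFunLike.congr_fun (h0 i) x
  rw [this, map_zero]

lemma exists_equiv {b : UnitaryDual G} (i : {i // D.irrep i = b}) :
    Nonempty (b.rep.Equiv (D.irrep i).rep) := by
  obtain ⟨i, rfl⟩ := i
  exact ⟨Representation.Equiv.refl _⟩

open Classical in
-- The inclusions of the copies of `b` are linearly independent, as the projections separate them.
-- Only this half of the multiplicity formula is needed.
lemma card_fiber_le_finrank_hom_from [FiniteDimensional ℂ V] (b : UnitaryDual G) :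
    Fintype.card {i // D.irrep i = b} ≤ repMultiplicity b.rep ρ := by
  let e := fun i : {i // D.irrep i = b} => (D.exists_equiv i).some
  let f : {i // D.irrep i = b} → IntertwiningMap b.rep ρ := fun i =>
    (D.incl i).comp (e i).toIntertwiningMap
  have hf : LinearIndependent ℂ f := by
    rw [Fintype.linearIndependent_iff]
    intro c hc j
    obtain ⟨x, hx⟩ := b.exists_ne_zero
    have h1 : ∑ i, c i • D.incl i (e i x) = 0 := by
      have := DFunLike.congr_fun hc x
      rwa [IntertwiningMap.sum_apply] at this
    have h2 := congrArg (D.proj j) h1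
    rw [map_sum, map_zero, Finset.sum_eq_single j, map_smul, D.proj_incl_self] at h2
    · refine (smul_eq_zero.1 h2).resolve_right fun h => hx ?_
      exact (e j).toLinearEquiv.map_eq_zero_iff.1 h
    · intro i _ hij
      rw [map_smul, D.proj_incl_ne _ _ (fun h => hij (Subtype.ext h.symm)), smul_zero]
    · simp
  exact hf.fintype_card_le_finrank

open Classical in
-- Same argument with projections in place of inclusions. Maps into `b` are the ones that an
-- invariant tensor turns into maps out of the dual of `b`.
lemma card_fiber_le_finrank_hom_to [FiniteDimensional ℂ V] (b : UnitaryDual G) :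
    Fintype.card {i // D.irrep i = b} ≤ repMultiplicity ρ b.rep := by
  let e := fun i : {i // D.irrep i = b} => (D.exists_equiv i).some
  let f : {i // D.irrep i = b} → IntertwiningMap ρ b.rep := fun i =>
    (e i).symm.toIntertwiningMap.comp (D.proj i)
  have hf : LinearIndependent ℂ f := by
    rw [Fintype.linearIndependent_iff]
    intro c hc j
    obtain ⟨x, hx⟩ := b.exists_ne_zero
    have h1 : ∑ i, c i • (e i).symm (D.proj i (D.incl j (e j x))) = 0 := by
      have := DFunLike.congr_fun hc (D.incl j (e j x))
      rwa [IntertwiningMap.sum_apply] at this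
    rw [Finset.sum_eq_single j, D.proj_incl_self, Representation.Equiv.symm_apply_apply] at h1
    · exact (smul_eq_zero.1 h1).resolve_right hx
    · intro i _ hij
      rw [D.proj_incl_ne _ _ (fun h => hij (Subtype.ext h)), map_zero, smul_zero]
    · simp
  exact hf.fintype_card_le_finrank

lemma finrank_eq : Module.finrank ℂ V = ∑ i, (D.irrep i).dim := by
  classical
  let e : V ≃ₗ[ℂ] ∀ i, EuclideanSpace ℂ (Fin (D.irrep i).dim) :=
    LinearEquiv.ofLinearMap (LinearMap.pi fun i => (D.proj i).toLinearMap)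
      (∑ i, (D.incl i).toLinearMap ∘ₗ LinearMap.proj i)
      (by
        refine LinearMap.ext fun x => funext fun j => ?_
        change D.proj j ((∑ i, (D.incl i).toLinearMap ∘ₗ LinearMap.proj i) x) = x j
        rw [LinearMap.sum_apply, map_sum, Finset.sum_eq_single j]
        · exact D.proj_incl_self j (x j)
        · intro i _ hij
          exact D.proj_incl_ne j i hij.symm (x i)
        · simp)
      (by
        refine LinearMap.ext fun v => ?_
        rw [LinearMap.comp_apply, LinearMap.sum_apply]
        exact D.sum_incl_proj v)
  rw [e.finrank_eq, Module.finrank_pi_fintype]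
  simp

open Classical in
lemma sum_irrep_eq (g : UnitaryDual G → ℕ) :
    ∑ i, g (D.irrep i) =
      ∑ b ∈ Finset.univ.image D.irrep, Fintype.card {i // D.irrep i = b} * g b := by
  rw [Finset.sum_comp g D.irrep]
  refine Finset.sum_congr rfl fun b _ => ?_
  rw [smul_eq_mul, Fintype.card_subtype]

open Classical in
-- Finite support is essential: `finsum` takes the value zero on functions of infinite support,
-- which would make the upper bounds false.
lemma irrepMult_support_subset {H : Type*} [NormedAddCommGroup H] [InnerProductSpace ℂ H]
    {U : UnitaryRep G H} (D : IrrepDecomposition U.rep) :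
    {b | irrepMult b U ≠ 0} ⊆ (Finset.univ.image D.irrep : Set (UnitaryDual G)) := by
  intro b hb
  have : ∃ f : IntertwiningMap b.rep U.rep, f ≠ 0 := by
    by_contra! h
    have : Subsingleton (IntertwiningMap b.rep U.rep) := ⟨fun x y => by rw [h x, h y]⟩
    exact hb (Module.finrank_zero_of_subsingleton)
  obtain ⟨f, hf⟩ := this
  obtain ⟨i, hi⟩ := D.exists_irrep_eq hf
  simpa using ⟨i, hi⟩

end IrrepDecomposition

lemma finite_irrepMult_support {H : Type*} [NormedAddCommGroup H] [InnerProductSpace ℂ H]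
    [FiniteDimensional ℂ H] (U : UnitaryRep G H) : {b | irrepMult b U ≠ 0}.Finite := by
  classical
  obtain ⟨D⟩ := U.nonempty_irrepDecomposition
  exact (Finset.finite_toSet _).subset D.irrepMult_support_subset

/-- The multiplicity in a tensor product is bounded by the Clebsch–Gordan sum. -/
lemma repMultiplicity_tprod_le {H K V : Type*} [NormedAddCommGroup H] [InnerProductSpace ℂ H]
    [FiniteDimensional ℂ H] [NormedAddCommGroup K] [InnerProductSpace ℂ K] [FiniteDimensional ℂ K]
    [AddCommGroup V] [Module ℂ V] [FiniteDimensional ℂ V]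
    (U : UnitaryRep G H) (U' : UnitaryRep G K) (σ : Representation ℂ G V) :
    repMultiplicity σ (U.rep.tprod U'.rep) ≤
      ∑ᶠ p : UnitaryDual G × UnitaryDual G,
        irrepMult p.1 U * irrepMult p.2 U' * repMultiplicity σ (p.1.rep.tprod p.2.rep) := by
  classical
  obtain ⟨D⟩ := U.nonempty_irrepDecomposition
  obtain ⟨E⟩ := U'.nonempty_irrepDecomposition
  let F : UnitaryDual G → UnitaryDual G → ℕ := fun b c => repMultiplicity σ (b.rep.tprod c.rep)
  let L : IntertwiningMap σ (U.rep.tprod U'.rep) →ₗ[ℂ]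
      ∀ p : D.ι × E.ι, IntertwiningMap σ ((D.irrep p.1).rep.tprod (E.irrep p.2).rep) :=
    LinearMap.pi fun p =>
      IntertwiningMap.llcomp σ _ _ (IntertwiningMap.tensor (D.proj p.1) (E.proj p.2))
  -- The identity factors through the products of irreducible summands, so an intertwiner is
  -- determined by its components there: `L` is injective.
  have hid : ∀ z : H ⊗[ℂ] K, ∑ p : D.ι × E.ι,
      IntertwiningMap.tensor (D.incl p.1) (E.incl p.2)
        (IntertwiningMap.tensor (D.proj p.1) (E.proj p.2) z) = z := by
    intro z
    induction z using TensorProduct.induction_on with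
    | zero => simp
    | add x y hx hy =>
      simp only [map_add, Finset.sum_add_distrib]
      rw [hx, hy]
    | tmul x y =>
      simp only [IntertwiningMap.tensor_apply]
      rw [Fintype.sum_prod_type]
      conv_rhs => rw [← D.sum_incl_proj x, ← E.sum_incl_proj y, TensorProduct.sum_tmul]
      refine Finset.sum_congr rfl fun i _ => ?_
      rw [TensorProduct.tmul_sum]
  have hL : Function.Injective L := by
    rw [injective_iff_map_eq_zero]
    intro f hf
    refine IntertwiningMap.ext (LinearMap.ext fun x => ?_)
    change f x = 0
    rw [← hid (f x)]
    refine Finset.sum_eq_zero fun p _ => ?_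
    have : IntertwiningMap.tensor (D.proj p.1) (E.proj p.2) (f x) = 0 :=
      DFunLike.congr_fun (congrFun hf p) x
    rw [this, map_zero]
  have h1 : repMultiplicity σ (U.rep.tprod U'.rep) ≤
      ∑ i, ∑ j, F (D.irrep i) (E.irrep j) := by
    refine (LinearMap.finrank_le_finrank_of_injective hL).trans ?_
    rw [Module.finrank_pi_fintype, Fintype.sum_prod_type]
    exact le_rfl
  refine h1.trans ?_
  rw [finsum_eq_sum_of_support_subset
    (s := (Finset.univ.image D.irrep) ×ˢ (Finset.univ.image E.irrep)), Finset.sum_product]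
  · rw [D.sum_irrep_eq fun b => ∑ j, F b (E.irrep j)]
    refine Finset.sum_le_sum fun b _ => ?_
    rw [E.sum_irrep_eq (F b), Finset.mul_sum]
    refine Finset.sum_le_sum fun c _ => ?_
    rw [← mul_assoc]
    exact Nat.mul_le_mul (Nat.mul_le_mul (D.card_fiber_le_finrank_hom_from b)
      (E.card_fiber_le_finrank_hom_from c)) le_rfl
  · intro p hp
    rw [Function.mem_support] at hp
    rw [Finset.coe_product]
    exact ⟨D.irrepMult_support_subset (left_ne_zero_of_mul (left_ne_zero_of_mul hp)),
      E.irrepMult_support_subset (right_ne_zero_of_mul (left_ne_zero_of_mul hp))⟩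

end Multiplicity

/-! ### Tensors as linear maps, and Schmidt rank. -/

section Contraction

variable {A B : Type*} [AddCommGroup A] [Module ℂ A] [AddCommGroup B] [Module ℂ B]

/-- A tensor in `A ⊗ B` viewed as a linear map from the dual of `A` to `B`. -/
def contractLeft (Ψ : A ⊗[ℂ] B) : Module.Dual ℂ A →ₗ[ℂ] B where
  toFun l := TensorProduct.lid ℂ B (LinearMap.rTensor B l Ψ)
  map_add' l l' := by rw [LinearMap.rTensor_add, LinearMap.add_apply, map_add]
  map_smul' c l := by rw [LinearMap.rTensor_smul, LinearMap.smul_apply, map_smul, RingHom.id_apply]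

/-- A tensor in `A ⊗ B` viewed as a linear map from the dual of `B` to `A`. -/
def contractRight (Ψ : A ⊗[ℂ] B) : Module.Dual ℂ B →ₗ[ℂ] A where
  toFun l := TensorProduct.rid ℂ A (LinearMap.lTensor A l Ψ)
  map_add' l l' := by rw [LinearMap.lTensor_add, LinearMap.add_apply, map_add]
  map_smul' c l := by rw [LinearMap.lTensor_smul, LinearMap.smul_apply, map_smul, RingHom.id_apply]

lemma contractLeft_apply (Ψ : A ⊗[ℂ] B) (l : Module.Dual ℂ A) :
    contractLeft Ψ l = TensorProduct.lid ℂ B (LinearMap.rTensor B l Ψ) := rfl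

lemma contractRight_apply (Ψ : A ⊗[ℂ] B) (l : Module.Dual ℂ B) :
    contractRight Ψ l = TensorProduct.rid ℂ A (LinearMap.lTensor A l Ψ) := rfl

lemma dual_contractLeft (Ψ : A ⊗[ℂ] B) (l : Module.Dual ℂ A) (m : Module.Dual ℂ B) :
    m (contractLeft Ψ l) = l (contractRight Ψ m) := by
  rw [contractLeft_apply, contractRight_apply]
  induction Ψ using TensorProduct.induction_on with
  | zero => simp
  | add x y hx hy => simp only [map_add, hx, hy]
  | tmul x y => simp [mul_comm]

/-- The two contractions are transposes of each other, up to `B ≃ B**`, and transposing preserves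
rank. -/
lemma finrank_range_contractLeft [FiniteDimensional ℂ B] (Ψ : A ⊗[ℂ] B) :
    Module.finrank ℂ (LinearMap.range (contractLeft Ψ)) =
      Module.finrank ℂ (LinearMap.range (contractRight Ψ)) := by
  rw [← LinearMap.finrank_range_dualMap_eq_finrank_range (contractRight Ψ)]
  have h : (contractRight Ψ).dualMap =
      (Module.evalEquiv ℂ B).toLinearMap ∘ₗ contractLeft Ψ := by
    refine LinearMap.ext fun l => LinearMap.ext fun m => ?_
    exact (dual_contractLeft Ψ l m).symm
  rw [h, LinearMap.range_comp]
  exact ((Module.evalEquiv ℂ B).submoduleMap _).finrank_eq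

lemma contractLeft_map {A' B' : Type*} [AddCommGroup A'] [Module ℂ A'] [AddCommGroup B']
    [Module ℂ B'] (f : A →ₗ[ℂ] A') (g : B →ₗ[ℂ] B') (Ψ : A ⊗[ℂ] B) (l : Module.Dual ℂ A') :
    contractLeft (TensorProduct.map f g Ψ) l = g (contractLeft Ψ (l ∘ₗ f)) := by
  rw [contractLeft_apply, contractLeft_apply]
  induction Ψ using TensorProduct.induction_on with
  | zero => simp
  | add x y hx hy => simp only [map_add, hx, hy]
  | tmul x y => simp

lemma contractRight_map {A' B' : Type*} [AddCommGroup A'] [Module ℂ A'] [AddCommGroup B']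
    [Module ℂ B'] (f : A →ₗ[ℂ] A') (g : B →ₗ[ℂ] B') (Ψ : A ⊗[ℂ] B) (l : Module.Dual ℂ B') :
    contractRight (TensorProduct.map f g Ψ) l = f (contractRight Ψ (l ∘ₗ g)) := by
  rw [contractRight_apply, contractRight_apply]
  induction Ψ using TensorProduct.induction_on with
  | zero => simp
  | add x y hx hy => simp only [map_add, hx, hy]
  | tmul x y => simp

end Contraction

/-! ### Schmidt rank of an invariant tensor. -/

section Rank

variable {G : Type*} [Group G] [TopologicalSpace G]
  {A B : Type*} [NormedAddCommGroup A] [InnerProductSpace ℂ A] [FiniteDimensional ℂ A]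
  [AddCommGroup B] [Module ℂ B] [FiniteDimensional ℂ B]

omit [TopologicalSpace G] [FiniteDimensional ℂ A] [FiniteDimensional ℂ B] in
lemma contractRight_comp_rep (ρ : Representation ℂ G A) (σ : Representation ℂ G B)
    {Ψ : A ⊗[ℂ] B} (hΨ : ∀ g, (ρ.tprod σ) g Ψ = Ψ) (g : G) (l : Module.Dual ℂ B) :
    ρ g (contractRight Ψ l) = contractRight Ψ (l ∘ₗ σ g⁻¹) := by
  have h := contractRight_map (ρ g) (σ g) Ψ (l ∘ₗ σ g⁻¹)
  rw [← Representation.tprod_apply, hΨ, LinearMap.comp_assoc, ← Module.End.mul_eq_comp, ← map_mul,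
    inv_mul_cancel, map_one] at h
  exact h.symm

omit [TopologicalSpace G] [FiniteDimensional ℂ A] [FiniteDimensional ℂ B] in
lemma contractLeft_comp_rep (ρ : Representation ℂ G A) (σ : Representation ℂ G B)
    {Ψ : A ⊗[ℂ] B} (hΨ : ∀ g, (ρ.tprod σ) g Ψ = Ψ) (g : G) (l : Module.Dual ℂ A) :
    contractLeft Ψ (l ∘ₗ ρ g⁻¹) = σ g (contractLeft Ψ l) := by
  have h := contractLeft_map (ρ g) (σ g) Ψ (l ∘ₗ ρ g⁻¹)
  rw [← Representation.tprod_apply, hΨ, LinearMap.comp_assoc, ← Module.End.mul_eq_comp, ← map_mul,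
    inv_mul_cancel, map_one] at h
  exact h

/-- The support on `A` of an invariant tensor in `A ⊗ B`. -/
def supportSubrep (U : UnitaryRep G A) (σ : Representation ℂ G B) (Ψ : A ⊗[ℂ] B)
    (hΨ : ∀ g, (U.rep.tprod σ) g Ψ = Ψ) : Subrepresentation U.rep where
  toSubmodule := LinearMap.range (contractRight Ψ)
  apply_mem_toSubmodule := by
    rintro g _ ⟨l, rfl⟩
    exact ⟨_, (contractRight_comp_rep _ _ hΨ g l).symm⟩

/-- Intertwining maps from the support of an invariant tensor in `A ⊗ B` to `b` give intertwining
maps from the dual of `b` to `B`. -/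
def supportHom (U : UnitaryRep G A) (σ : Representation ℂ G B) (Ψ : A ⊗[ℂ] B)
    (hΨ : ∀ g, (U.rep.tprod σ) g Ψ = Ψ) {V : Type*} [AddCommGroup V] [Module ℂ V]
    (τ : Representation ℂ G V) :
    IntertwiningMap (U.restrict (supportSubrep U σ Ψ hΨ)).rep τ →ₗ[ℂ]
      IntertwiningMap τ.dual σ where
  toFun f := LinearMap.intertwiningMap_of_isIntertwiningMap _ _
    (contractLeft Ψ ∘ₗ
      (f.toLinearMap ∘ₗ (U.projection (supportSubrep U σ Ψ hΨ)).toLinearMap).dualMap) fun g l => by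
    have h : (l ∘ₗ τ g⁻¹) ∘ₗ (f.toLinearMap ∘ₗ
        (U.projection (supportSubrep U σ Ψ hΨ)).toLinearMap) =
      (l ∘ₗ (f.toLinearMap ∘ₗ (U.projection (supportSubrep U σ Ψ hΨ)).toLinearMap)) ∘ₗ
        U.rep g⁻¹ := by
      refine LinearMap.ext fun x => ?_
      change l (τ g⁻¹ (f (U.projection _ x))) = l (f (U.projection _ (U.rep g⁻¹ x)))
      rw [IntertwiningMap.isIntertwining, IntertwiningMap.isIntertwining]
    change contractLeft Ψ ((l ∘ₗ τ g⁻¹) ∘ₗ _) = σ g (contractLeft Ψ (l ∘ₗ _))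
    rw [h, contractLeft_comp_rep _ _ hΨ]
  map_add' f f' := by
    refine IntertwiningMap.ext (LinearMap.ext fun l => ?_)
    change contractLeft Ψ _ = contractLeft Ψ _ + contractLeft Ψ _
    rw [← map_add]
    congr 1
    refine LinearMap.ext fun x => ?_
    exact map_add l _ _
  map_smul' c f := by
    refine IntertwiningMap.ext (LinearMap.ext fun l => ?_)
    change contractLeft Ψ _ = c • contractLeft Ψ _
    rw [← map_smul]
    congr 1
    refine LinearMap.ext fun x => ?_
    exact map_smul l _ _

omit [FiniteDimensional ℂ B] in
-- A vector of the support is `w = contractRight Ψ m`. Pairing the image of `l` with `m` gives `l (f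
-- w)` by transposition, so a vanishing image forces `f w = 0`.
lemma supportHom_injective (U : UnitaryRep G A) (σ : Representation ℂ G B) (Ψ : A ⊗[ℂ] B)
    (hΨ : ∀ g, (U.rep.tprod σ) g Ψ = Ψ) {V : Type*} [AddCommGroup V] [Module ℂ V]
    (τ : Representation ℂ G V) : Function.Injective (supportHom U σ Ψ hΨ τ) := by
  rw [injective_iff_map_eq_zero]
  intro f hf
  refine IntertwiningMap.ext (LinearMap.ext fun w => ?_)
  change f w = 0
  rw [← Module.forall_dual_apply_eq_zero_iff ℂ]
  intro l
  obtain ⟨m, hm⟩ := w.2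
  have h0 : contractLeft Ψ (l ∘ₗ (f.toLinearMap ∘ₗ
      (U.projection (supportSubrep U σ Ψ hΨ)).toLinearMap)) = 0 := DFunLike.congr_fun hf l
  have h1 := dual_contractLeft Ψ (l ∘ₗ (f.toLinearMap ∘ₗ
      (U.projection (supportSubrep U σ Ψ hΨ)).toLinearMap)) m
  rw [h0, map_zero, hm] at h1
  have h2 : U.projection (supportSubrep U σ Ψ hΨ) (w : A) = w := U.projection_inclusion _ w
  have h3 : l (f (U.projection (supportSubrep U σ Ψ hΨ) (w : A))) = 0 := h1.symm
  rwa [h2] at h3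

/-- The Schmidt rank of an invariant tensor in `A ⊗ B` is bounded by the dimension of the part of
`A` whose conjugate occurs in `B`. -/
lemma finrank_range_contractRight_le (U : UnitaryRep G A) (σ : Representation ℂ G B)
    (Ψ : A ⊗[ℂ] B) (hΨ : ∀ g, (U.rep.tprod σ) g Ψ = Ψ) (F : UnitaryDual G → ℕ)
    (hF : ∀ b, repMultiplicity b.rep.dual σ ≤ F b) :
    Module.finrank ℂ (LinearMap.range (contractRight Ψ)) ≤
      ∑ᶠ b : UnitaryDual G, b.dim * min (irrepMult b U) (F b) := by
  classical
  let W := supportSubrep U σ Ψ hΨ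
  obtain ⟨D⟩ := (U.restrict W).nonempty_irrepDecomposition
  have h1 : Module.finrank ℂ (LinearMap.range (contractRight Ψ)) = ∑ i, (D.irrep i).dim :=
    D.finrank_eq
  have h2 : ∀ b, Fintype.card {i // D.irrep i = b} ≤ irrepMult b U := fun b => by
    refine (D.card_fiber_le_finrank_hom_from b).trans ?_
    refine LinearMap.finrank_le_finrank_of_injective
      (f := IntertwiningMap.llcomp b.rep _ _ (U.inclusion W)) fun f f' h => ?_
    refine IntertwiningMap.ext (LinearMap.ext fun x => Subtype.ext ?_)
    exact DFunLike.congr_fun h x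
  -- The conjugate bound: each copy of `b` in the support yields an independent map from the dual of
  -- `b` to `B`.
  have h3 : ∀ b, Fintype.card {i // D.irrep i = b} ≤ F b := fun b =>
    (D.card_fiber_le_finrank_hom_to b).trans
      ((LinearMap.finrank_le_finrank_of_injective
        (supportHom_injective U σ Ψ hΨ b.rep)).trans (hF b))
  have hfin := finite_irrepMult_support U
  rw [h1, D.sum_irrep_eq UnitaryDual.dim, finsum_eq_sum_of_support_subset
    (s := hfin.toFinset ∪ Finset.univ.image D.irrep)]
  · refine (Finset.sum_le_sum fun b _ => ?_).trans
      (Finset.sum_le_sum_of_subset Finset.subset_union_right)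
    rw [mul_comm]
    exact Nat.mul_le_mul le_rfl (le_min (h2 b) (h3 b))
  · intro b hb
    rw [Finset.coe_union]
    left
    rw [Set.Finite.coe_toFinset]
    intro h0
    rw [Function.mem_support, h0, Nat.zero_min, mul_zero] at hb
    exact hb rfl

lemma finrank_range_contractRight_le_dEff {B K : Type*} [NormedAddCommGroup B]
    [InnerProductSpace ℂ B] [FiniteDimensional ℂ B] [NormedAddCommGroup K] [InnerProductSpace ℂ K]
    [FiniteDimensional ℂ K] (U : UnitaryRep G A) (U' : UnitaryRep G B) (V : UnitaryRep G K)
    (Ψ : A ⊗[ℂ] (B ⊗[ℂ] K)) (hΨ : ∀ g, (U.rep.tprod (U'.rep.tprod V.rep)) g Ψ = Ψ) :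
    Module.finrank ℂ (LinearMap.range (contractRight Ψ)) ≤ dEff U U' V :=
  finrank_range_contractRight_le U _ Ψ hΨ _ fun b => repMultiplicity_tprod_le U' V b.rep.dual

end Rank

/-! ### Rényi entropies lie between zero and the log of the rank. -/

section Entropy

variable {ι : Type*} [Fintype ι] {p : ι → ℝ}

lemma le_one_of_sum_eq_one (hp : ∀ i, 0 ≤ p i) (hsum : ∑ i, p i = 1) (i : ι) : p i ≤ 1 :=
  hsum ▸ Finset.single_le_sum (fun j _ => hp j) (Finset.mem_univ i)

lemma sum_eq_sum_support {f : ℝ → ℝ} (hf : f 0 = 0) :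
    ∑ i, f (p i) = ∑ i with p i ≠ 0, f (p i) := by
  symm
  apply Finset.sum_subset (Finset.subset_univ _)
  intro i _ hi
  have : p i = 0 := by simpa using hi
  rw [this, hf]

lemma card_support_pos (hsum : ∑ i, p i = 1) : 0 < (Finset.univ.filter fun i => p i ≠ 0).card := by
  rw [Finset.card_pos]
  by_contra h
  rw [Finset.not_nonempty_iff_eq_empty] at h
  have := sum_eq_sum_support (p := p) (f := id) rfl
  rw [h] at this
  simp [hsum] at this

lemma shannon_nonneg (hp : ∀ i, 0 ≤ p i) (hsum : ∑ i, p i = 1) : 0 ≤ ∑ i, Real.negMulLog (p i) :=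
  Finset.sum_nonneg fun i _ => Real.negMulLog_nonneg (hp i) (le_one_of_sum_eq_one hp hsum i)

/-- Jensen's inequality for `negMulLog` with uniform weights on the support. -/
lemma shannon_le (hp : ∀ i, 0 ≤ p i) (hsum : ∑ i, p i = 1) :
    ∑ i, Real.negMulLog (p i) ≤ Real.log (Finset.univ.filter fun i => p i ≠ 0).card := by
  have hpos := card_support_pos hsum
  set s := Finset.univ.filter fun i => p i ≠ 0 with hs
  have hr : (0 : ℝ) < s.card := by exact_mod_cast hpos
  rw [sum_eq_sum_support Real.negMulLog_zero, ← hs]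
  have h := Real.concaveOn_negMulLog.le_map_sum (t := s) (w := fun _ => (s.card : ℝ)⁻¹) (p := p)
    (fun _ _ => by positivity) (by simp [hr.ne']) (fun i _ => hp i)
  have h1 : ∑ i ∈ s, p i = 1 := by
    rw [← hsum]
    exact (sum_eq_sum_support (p := p) (f := id) rfl).symm
  simp only [smul_eq_mul, ← Finset.mul_sum] at h
  rw [h1, mul_one, Real.negMulLog, Real.log_inv, neg_mul_neg] at h
  exact le_of_mul_le_mul_left h (by positivity)

/-- With `n` the size of the support, `p i ^ α ≤ p i` and the power mean inequality give `n ^ (1 -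
α) ≤ ∑ p i ^ α ≤ 1`; the negative factor `1 / (1 - α)` reverses both bounds. -/
lemma renyi_bounds_of_one_lt (hp : ∀ i, 0 ≤ p i) (hsum : ∑ i, p i = 1) {α : ℝ} (hα : 1 < α) :
    0 ≤ 1 / (1 - α) * Real.log (∑ i, p i ^ α) ∧
      1 / (1 - α) * Real.log (∑ i, p i ^ α) ≤
        Real.log (Finset.univ.filter fun i => p i ≠ 0).card := by
  have hpos := card_support_pos hsum
  have h0 : (0 : ℝ) ^ α = 0 := Real.zero_rpow (by linarith)
  rw [sum_eq_sum_support (f := fun x => x ^ α) h0]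
  set s := Finset.univ.filter fun i => p i ≠ 0 with hs
  have hr : (0 : ℝ) < s.card := by exact_mod_cast hpos
  have h1 : ∑ i ∈ s, p i = 1 := by
    rw [← hsum]
    exact (sum_eq_sum_support (p := p) (f := id) rfl).symm
  have hle : ∑ i ∈ s, p i ^ α ≤ 1 := by
    rw [← h1]
    exact Finset.sum_le_sum fun i _ =>
      Real.rpow_le_self_of_le_one (hp i) (le_one_of_sum_eq_one hp hsum i) hα.le
  have hge := Real.rpow_sum_le_const_mul_sum_rpow_of_nonneg s hα.le (fun i _ => hp i)
  rw [h1, Real.one_rpow] at hge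
  have hX : 0 < ∑ i ∈ s, p i ^ α := by
    by_contra hX
    have : (s.card : ℝ) ^ (α - 1) * ∑ i ∈ s, p i ^ α ≤ 0 :=
      mul_nonpos_of_nonneg_of_nonpos (by positivity) (not_lt.1 hX)
    linarith
  have hlog : 0 ≤ (α - 1) * Real.log s.card + Real.log (∑ i ∈ s, p i ^ α) := by
    rw [← Real.log_rpow hr, ← Real.log_mul (by positivity) hX.ne']
    exact Real.log_nonneg hge
  have hlog' : Real.log (∑ i ∈ s, p i ^ α) ≤ 0 := Real.log_nonpos hX.le hle
  have hneg : 1 - α < 0 := by linarith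
  constructor
  · exact mul_nonneg_of_nonpos_of_nonpos (one_div_neg.2 hneg).le hlog'
  · rw [one_div, inv_mul_eq_div, div_le_iff_of_neg hneg]
    linarith

lemma renyi_bounds_of_lt_one (hp : ∀ i, 0 ≤ p i) (hsum : ∑ i, p i = 1) {α : ℝ} (hα : 0 < α)
    (hα' : α < 1) :
    0 ≤ 1 / (1 - α) * Real.log (∑ i, p i ^ α) ∧
      1 / (1 - α) * Real.log (∑ i, p i ^ α) ≤
        Real.log (Finset.univ.filter fun i => p i ≠ 0).card := by
  have hpos := card_support_pos hsum
  have h0 : (0 : ℝ) ^ α = 0 := Real.zero_rpow hα.ne'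
  rw [sum_eq_sum_support (f := fun x => x ^ α) h0]
  set s := Finset.univ.filter fun i => p i ≠ 0 with hs
  have hr : (0 : ℝ) < s.card := by exact_mod_cast hpos
  have h1 : ∑ i ∈ s, p i = 1 := by
    rw [← hsum]
    exact (sum_eq_sum_support (p := p) (f := id) rfl).symm
  have hge : 1 ≤ ∑ i ∈ s, p i ^ α := by
    rw [← h1]
    exact Finset.sum_le_sum fun i _ =>
      Real.self_le_rpow_of_le_one (hp i) (le_one_of_sum_eq_one hp hsum i) hα'.le
  -- The power mean inequality needs an exponent at least one, so it is applied to `p i ^ α` with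
  -- exponent `α⁻¹`.
  have hle := Real.rpow_sum_le_const_mul_sum_rpow_of_nonneg s (p := α⁻¹)
    ((one_le_inv₀ hα).2 hα'.le) (f := fun i => p i ^ α) (fun i _ => Real.rpow_nonneg (hp i) _)
  simp only [← Real.rpow_mul (hp _), mul_inv_cancel₀ hα.ne', Real.rpow_one, h1, mul_one] at hle
  have hX : 0 < ∑ i ∈ s, p i ^ α := by linarith
  have hlog := Real.log_le_log (by positivity) hle
  rw [Real.log_rpow hX, Real.log_rpow hr] at hlog
  have hlog' : Real.log (∑ i ∈ s, p i ^ α) ≤ (1 - α) * Real.log s.card := by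
    have h := mul_le_mul_of_nonneg_left hlog hα.le
    rwa [← mul_assoc, mul_inv_cancel₀ hα.ne', one_mul, ← mul_assoc, mul_sub,
      mul_inv_cancel₀ hα.ne', mul_one] at h
  have hneg : 0 < 1 - α := by linarith
  constructor
  · exact mul_nonneg (by positivity) (Real.log_nonneg hge)
  · rw [one_div, inv_mul_le_iff₀ hneg]
    exact hlog'

variable {K : Type*} [NormedAddCommGroup K] [InnerProductSpace ℂ K] [FiniteDimensional ℂ K]
  {T : K →ₗ[ℂ] K}

lemma eigenvalueMultiset_eq (hT : T.IsSymmetric) :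
    eigenvalueMultiset T = Multiset.map (hT.eigenvalues rfl) Finset.univ.val := by
  rw [eigenvalueMultiset, hT.roots_charpoly_eq_eigenvalues rfl, Multiset.map_map]
  rfl

/-- Eigenvectors for nonzero eigenvalues lie in the range and are orthonormal. -/
lemma card_eigenvalues_ne_zero_le (hT : T.IsSymmetric) :
    (Finset.univ.filter fun i => hT.eigenvalues rfl i ≠ 0).card ≤
      Module.finrank ℂ (LinearMap.range T) := by
  let e := hT.eigenvectorBasis rfl
  let f : {i // hT.eigenvalues rfl i ≠ 0} → LinearMap.range T := fun i =>
    ⟨e i, ((hT.eigenvalues rfl i : ℂ))⁻¹ • e i, by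
      rw [map_smul, hT.apply_eigenvectorBasis, smul_smul]
      exact (congrArg (· • e i) (inv_mul_cancel₀ (Complex.ofReal_ne_zero.2 i.2))).trans
        (one_smul ℂ _)⟩
  have hf : LinearIndependent ℂ f :=
    LinearIndependent.of_comp (LinearMap.range T).subtype
      (e.orthonormal.linearIndependent.comp _ Subtype.val_injective)
  rw [← Fintype.card_subtype]
  exact hf.fintype_card_le_finrank

/-- The Rényi entropies of a density operator lie between zero and the logarithm of its rank. -/
lemma renyiEntropy_bounds (hT : T.IsPositive) (htr : LinearMap.trace ℂ K T = 1) {α : ℝ}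
    (hα : 0 < α) :
    0 < Module.finrank ℂ (LinearMap.range T) ∧ 0 ≤ renyiEntropy α T ∧
      renyiEntropy α T ≤ Real.log (Module.finrank ℂ (LinearMap.range T)) := by
  have hp : ∀ i, 0 ≤ hT.isSymmetric.eigenvalues rfl i := hT.nonneg_eigenvalues rfl
  have hsum : ∑ i, hT.isSymmetric.eigenvalues rfl i = 1 := by
    rw [hT.isSymmetric.trace_eq_sum_eigenvalues rfl] at htr
    exact Complex.ofReal_injective htr
  have hcard := card_eigenvalues_ne_zero_le hT.isSymmetric
  have hpos := card_support_pos hsum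
  have hlog := Real.log_le_log (by exact_mod_cast hpos)
    (Nat.cast_le (α := ℝ).2 hcard)
  refine ⟨hpos.trans_le hcard, ?_⟩
  rw [renyiEntropy, eigenvalueMultiset_eq hT.isSymmetric, Multiset.map_map, Multiset.map_map]
  split_ifs with h
  · exact ⟨shannon_nonneg hp hsum, (shannon_le hp hsum).trans hlog⟩
  · rcases lt_or_gt_of_ne h with h | h
    · have := renyi_bounds_of_lt_one hp hsum hα h
      exact ⟨this.1, this.2.trans hlog⟩
    · have := renyi_bounds_of_one_lt hp hsum h
      exact ⟨this.1, this.2.trans hlog⟩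

end Entropy

/-! ### Marginals of a pure state. -/

section PureState

variable {A B : Type*} [NormedAddCommGroup A] [InnerProductSpace ℂ A]
  [NormedAddCommGroup B] [InnerProductSpace ℂ B]

lemma braLeft_apply (a : A) (χ : A ⊗[ℂ] B) : braLeft B a χ = contractLeft χ (innerₛₗ ℂ a) := rfl

lemma inner_braLeft (a : A) (b : B) (χ : A ⊗[ℂ] B) :
    inner ℂ b (braLeft B a χ) = inner ℂ (a ⊗ₜ[ℂ] b) χ := by
  induction χ using TensorProduct.induction_on with
  | zero => simp
  | add x y hx hy => rw [map_add, inner_add_right, inner_add_right, hx, hy]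
  | tmul x y => simp [braLeft]

lemma inner_braRight (a : A) (b : B) (χ : A ⊗[ℂ] B) :
    inner ℂ a (braRight A b χ) = inner ℂ (a ⊗ₜ[ℂ] b) χ := by
  induction χ using TensorProduct.induction_on with
  | zero => simp
  | add x y hx hy => rw [map_add, inner_add_right, inner_add_right, hx, hy]
  | tmul x y => simp [braRight, mul_comm]

lemma inner_braLeft_left (a : A) (b : B) (χ : A ⊗[ℂ] B) :
    inner ℂ (braLeft B a χ) b = inner ℂ χ (a ⊗ₜ[ℂ] b) := by
  rw [← inner_conj_symm, inner_braLeft]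
  exact inner_conj_symm (𝕜 := ℂ) χ (a ⊗ₜ[ℂ] b)

lemma inner_braRight_left (a : A) (b : B) (χ : A ⊗[ℂ] B) :
    inner ℂ (braRight A b χ) a = inner ℂ χ (a ⊗ₜ[ℂ] b) := by
  rw [← inner_conj_symm, inner_braRight]
  exact inner_conj_symm (𝕜 := ℂ) χ (a ⊗ₜ[ℂ] b)

lemma ketBra_apply (χ x : A) : ketBra χ x = inner ℂ χ x • χ := rfl

variable [FiniteDimensional ℂ A] [FiniteDimensional ℂ B]

omit [FiniteDimensional ℂ A] in
lemma sum_inner_braLeft {ι : Type*} [Fintype ι] (e : OrthonormalBasis ι ℂ A) (χ : A ⊗[ℂ] B) :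
    ∑ i, inner ℂ (braLeft B (e i) χ) (braLeft B (e i) χ) = inner ℂ χ χ := by
  let f := stdOrthonormalBasis ℂ B
  rw [← (e.tensorProduct f).sum_inner_mul_inner χ χ, Fintype.sum_prod_type]
  refine Finset.sum_congr rfl fun i _ => ?_
  rw [← f.sum_inner_mul_inner]
  refine Finset.sum_congr rfl fun j _ => ?_
  rw [OrthonormalBasis.tensorProduct_apply, inner_braLeft, inner_braLeft_left]

omit [FiniteDimensional ℂ B] in
lemma sum_inner_braRight {ι : Type*} [Fintype ι] (f : OrthonormalBasis ι ℂ B) (χ : A ⊗[ℂ] B) :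
    ∑ i, inner ℂ (braRight A (f i) χ) (braRight A (f i) χ) = inner ℂ χ χ := by
  let e := stdOrthonormalBasis ℂ A
  rw [← (e.tensorProduct f).sum_inner_mul_inner χ χ, Fintype.sum_prod_type_right]
  refine Finset.sum_congr rfl fun i _ => ?_
  rw [← e.sum_inner_mul_inner]
  refine Finset.sum_congr rfl fun j _ => ?_
  rw [OrthonormalBasis.tensorProduct_apply, inner_braRight, inner_braRight_left]

omit [FiniteDimensional ℂ B] in
-- The marginal is a sum of unnormalized pure states, one per basis vector traced out; positivity,
-- trace and range are read off from this form.
lemma traceLeft_ketBra_apply (χ : A ⊗[ℂ] B) (y : B) :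
    traceLeft (ketBra χ) y = ∑ i, inner ℂ (braLeft B (stdOrthonormalBasis ℂ A i) χ) y •
      braLeft B (stdOrthonormalBasis ℂ A i) χ := by
  rw [traceLeft, LinearMap.sum_apply]
  refine Finset.sum_congr rfl fun i _ => ?_
  rw [LinearMap.comp_apply, LinearMap.comp_apply, TensorProduct.mk_apply, ketBra_apply, map_smul,
    inner_braLeft_left]

omit [FiniteDimensional ℂ B] in
lemma isPositive_traceLeft_ketBra (χ : A ⊗[ℂ] B) : (traceLeft (ketBra χ)).IsPositive := by
  constructor
  · intro x y
    rw [traceLeft_ketBra_apply, traceLeft_ketBra_apply, sum_inner, inner_sum]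
    refine Finset.sum_congr rfl fun i _ => ?_
    rw [inner_smul_left, inner_smul_right, inner_conj_symm, mul_comm]
  · intro x
    rw [traceLeft_ketBra_apply, sum_inner, map_sum]
    refine Finset.sum_nonneg fun i _ => ?_
    rw [inner_smul_left, RCLike.conj_mul]
    norm_cast
    positivity

lemma trace_traceLeft_ketBra (χ : A ⊗[ℂ] B) :
    LinearMap.trace ℂ B (traceLeft (ketBra χ)) = inner ℂ χ χ := by
  rw [LinearMap.trace_eq_sum_inner _ (stdOrthonormalBasis ℂ B),
    ← sum_inner_braLeft (stdOrthonormalBasis ℂ A)]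
  simp only [traceLeft_ketBra_apply, inner_sum, inner_smul_right]
  rw [Finset.sum_comm]
  refine Finset.sum_congr rfl fun i _ => ?_
  exact (stdOrthonormalBasis ℂ B).sum_inner_mul_inner _ _

omit [FiniteDimensional ℂ B] in
lemma range_traceLeft_ketBra_le (χ : A ⊗[ℂ] B) :
    LinearMap.range (traceLeft (ketBra χ)) ≤ LinearMap.range (contractLeft χ) := by
  rintro _ ⟨y, rfl⟩
  rw [traceLeft_ketBra_apply]
  exact Submodule.sum_mem _ fun i _ => Submodule.smul_mem _ _ ⟨_, rfl⟩

omit [FiniteDimensional ℂ A] in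
lemma range_traceRight_ketBra_le (χ : A ⊗[ℂ] B) :
    LinearMap.range (traceRight (ketBra χ)) ≤ LinearMap.range (contractRight χ) := by
  rintro _ ⟨y, rfl⟩
  rw [traceRight, LinearMap.sum_apply]
  refine Submodule.sum_mem _ fun i _ => ?_
  rw [LinearMap.comp_apply, LinearMap.comp_apply, ketBra_apply, map_smul]
  exact Submodule.smul_mem _ _ ⟨_, rfl⟩

omit [FiniteDimensional ℂ A] in
lemma finrank_range_traceRight_ketBra_le (χ : A ⊗[ℂ] B) :
    Module.finrank ℂ (LinearMap.range (traceRight (ketBra χ))) ≤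
      Module.finrank ℂ (LinearMap.range (contractRight χ)) :=
  Submodule.finrank_mono (range_traceRight_ketBra_le χ)

lemma finrank_range_traceLeft_ketBra_le (χ : A ⊗[ℂ] B) :
    Module.finrank ℂ (LinearMap.range (traceLeft (ketBra χ))) ≤
      Module.finrank ℂ (LinearMap.range (contractRight χ)) :=
  (Submodule.finrank_mono (range_traceLeft_ketBra_le χ)).trans (finrank_range_contractLeft χ).le

/-- Relational states are pure: the factor `d` enters the vector as `√d`. -/
lemma smul_comp_ketBra_comp_adjoint (L : A →ₗ[ℂ] B) (ψ : A) (d : ℕ) :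
    (d : ℂ) • (L ∘ₗ ketBra ψ ∘ₗ LinearMap.adjoint L) = ketBra (((√d : ℝ) : ℂ) • L ψ) := by
  refine LinearMap.ext fun y => ?_
  rw [LinearMap.smul_apply, LinearMap.comp_apply, LinearMap.comp_apply, ketBra_apply, ketBra_apply,
    map_smul, LinearMap.adjoint_inner_right, inner_smul_left, smul_smul, smul_smul,
    Complex.conj_ofReal, mul_right_comm, ← Complex.ofReal_mul, Real.mul_self_sqrt d.cast_nonneg,
    Complex.ofReal_natCast]

end PureState

/-! ### Normalization of the conditioned state. -/

section Frame

variable {G : Type*} [Group G] [TopologicalSpace G] [CompactSpace G] [MeasurableSpace G]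
  [BorelSpace G] {μ : MeasureTheory.Measure G} [MeasureTheory.IsProbabilityMeasure μ]
  {B C : Type*} [NormedAddCommGroup B] [InnerProductSpace ℂ B] [FiniteDimensional ℂ B]
  [NormedAddCommGroup C] [InnerProductSpace ℂ C] [FiniteDimensional ℂ C]

omit [Group G] [InnerProductSpace ℂ B] [FiniteDimensional ℂ B] in
lemma integrable_of_continuous {f : G → B} (hf : Continuous f) : MeasureTheory.Integrable f μ :=
  hf.integrable_of_hasCompactSupport (HasCompactSupport.of_compactSpace f)

/-- The resolution of the identity applied to `w` and paired with `w`. -/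
lemma CompleteFrame.finrank_mul_integral (R : CompleteFrame G μ B) (w : B) :
    (Module.finrank ℂ B : ℂ) *
      ∫ g, inner ℂ (R.rep g R.seed) w * inner ℂ w (R.rep g R.seed) ∂μ = inner ℂ w w := by
  have hc := R.continuous_orbit R.seed
  have hint : MeasureTheory.Integrable
      (fun g => (inner ℂ (R.rep g R.seed) w : ℂ) • R.rep g R.seed) μ :=
    integrable_of_continuous ((hc.inner continuous_const).smul hc)
  have h := congrArg (inner ℂ w) (R.resolution_identity w)
  rw [inner_smul_right, ← integral_inner hint] at h
  simpa only [inner_smul_right] using h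

/-- Conditioning an invariant vector on the seed of a complete frame yields a vector of norm
`1 / √d` times the norm of the original one. -/
lemma CompleteFrame.finrank_mul_inner_braLeft (R : CompleteFrame G μ B)
    (σ : Representation ℂ G C) (hσ : ∀ g z, inner ℂ (σ g z) (σ g z) = inner ℂ z z)
    {Ψ : B ⊗[ℂ] C} (hΨ : ∀ g, (R.rep.tprod σ) g Ψ = Ψ) :
    (Module.finrank ℂ B : ℂ) * inner ℂ (braLeft C R.seed Ψ) (braLeft C R.seed Ψ) =
      inner ℂ Ψ Ψ := by
  let f := stdOrthonormalBasis ℂ C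
  -- By invariance, conditioning on the rotated seed rotates the result by `σ g`, so its norm is
  -- constant in `g` and may be averaged.
  have hconst : ∀ g, inner ℂ (braLeft C (R.rep g R.seed) Ψ) (braLeft C (R.rep g R.seed) Ψ) =
      inner ℂ (braLeft C R.seed Ψ) (braLeft C R.seed Ψ) := fun g => by
    rw [← hσ g (braLeft C R.seed Ψ)]
    have h : braLeft C (R.rep g R.seed) Ψ = σ g (braLeft C R.seed Ψ) := by
      rw [braLeft_apply, braLeft_apply]
      conv_lhs => rw [← hΨ g, Representation.tprod_apply, contractLeft_map]
      congr 2
      exact LinearMap.ext fun x => R.inner_map g R.seed x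
    rw [h]
  -- A basis of `C` splits `Ψ` into vectors of `B`, to each of which the resolution of the identity
  -- applies.
  have hexp : ∀ v, inner ℂ (braLeft C v Ψ) (braLeft C v Ψ) =
      ∑ k, inner ℂ v (braRight B (f k) Ψ) * inner ℂ (braRight B (f k) Ψ) v := fun v => by
    rw [← f.sum_inner_mul_inner]
    refine Finset.sum_congr rfl fun k _ => ?_
    rw [inner_braLeft, inner_braRight, inner_braLeft_left, inner_braRight_left, mul_comm]
  have hc := R.continuous_orbit R.seed
  have hint : ∫ g, inner ℂ (braLeft C (R.rep g R.seed) Ψ) (braLeft C (R.rep g R.seed) Ψ) ∂μ =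
      inner ℂ (braLeft C R.seed Ψ) (braLeft C R.seed Ψ) := by
    simp only [hconst]
    simp
  rw [← hint]
  simp only [hexp]
  rw [MeasureTheory.integral_finsetSum, Finset.mul_sum]
  · simp only [R.finrank_mul_integral]
    exact sum_inner_braRight f Ψ
  · intro k _
    exact integrable_of_continuous
      ((hc.inner continuous_const).mul (continuous_const.inner hc))

end Frame

/-! ### Relational states and exchange of the frames. -/

section Perspective

variable {A B K : Type*} [NormedAddCommGroup A] [InnerProductSpace ℂ A]
  [NormedAddCommGroup B] [InnerProductSpace ℂ B] [NormedAddCommGroup K] [InnerProductSpace ℂ K]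

lemma norm_leftComm (ψ : A ⊗[ℂ] (B ⊗[ℂ] K)) : ‖TensorProduct.leftComm ℂ A B K ψ‖ = ‖ψ‖ := by
  have h : TensorProduct.leftComm ℂ A B K ψ = TensorProduct.assocIsometry ℂ B A K
      ((TensorProduct.commIsometry ℂ A B).rTensor K
        ((TensorProduct.assocIsometry ℂ A B K).symm ψ)) := rfl
  rw [h, LinearIsometryEquiv.norm_map, LinearIsometryEquiv.norm_map, LinearIsometryEquiv.norm_map]

lemma leftComm_tprod {G : Type*} [Group G] (ρ : Representation ℂ G A) (σ : Representation ℂ G B)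
    (τ : Representation ℂ G K) (g : G) (ψ : A ⊗[ℂ] (B ⊗[ℂ] K)) :
    TensorProduct.leftComm ℂ A B K ((ρ.tprod (σ.tprod τ)) g ψ) =
      (σ.tprod (ρ.tprod τ)) g (TensorProduct.leftComm ℂ A B K ψ) := by
  simp only [Representation.tprod_apply]
  induction ψ using TensorProduct.induction_on with
  | zero => simp
  | add x y hx hy => simp only [map_add, hx, hy]
  | tmul x y =>
    induction y using TensorProduct.induction_on with
    | zero => simp
    | add y z hy hz => simp only [map_add, TensorProduct.tmul_add, hy, hz]
    | tmul y z => simp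

/-- Reordering the factors reduces the perspective of the second frame to that of the first. -/
lemma bra₂_eq_braLeft_leftComm (φ : B) (ψ : A ⊗[ℂ] (B ⊗[ℂ] K)) :
    bra₂ φ ψ = braLeft (A ⊗[ℂ] K) φ (TensorProduct.leftComm ℂ A B K ψ) := by
  induction ψ using TensorProduct.induction_on with
  | zero => simp
  | add x y hx hy => simp only [map_add, hx, hy]
  | tmul x y =>
    induction y using TensorProduct.induction_on with
    | zero => simp
    | add y z hy hz => simp only [map_add, TensorProduct.tmul_add, hy, hz]
    | tmul y z => simp [bra₂, braLeft]

/-- Conditioning on `φ` and then contracting with `l` is contraction with one product functional on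
`B ⊗ K`; hence conditioning cannot enlarge the support on `A`. -/
lemma contractRight_braLeft (φ : B) (Ψ : B ⊗[ℂ] (A ⊗[ℂ] K)) (l : Module.Dual ℂ K) :
    contractRight (braLeft (A ⊗[ℂ] K) φ Ψ) l =
      contractRight (TensorProduct.leftComm ℂ B A K Ψ) (l ∘ₗ braLeft K φ) := by
  simp only [contractRight_apply]
  induction Ψ using TensorProduct.induction_on with
  | zero => simp
  | add x y hx hy => simp only [map_add, hx, hy]
  | tmul x y =>
    induction y using TensorProduct.induction_on with
    | zero => simp
    | add y z hy hz => simp only [map_add, TensorProduct.tmul_add, hy, hz]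
    | tmul y z => simp [braLeft, smul_smul]

lemma UnitaryRep.inner_tprod {G : Type*} [Group G] [TopologicalSpace G] (U : UnitaryRep G A)
    (V : UnitaryRep G K) (g : G) (z : A ⊗[ℂ] K) :
    inner ℂ ((U.rep.tprod V.rep) g z) ((U.rep.tprod V.rep) g z) = inner ℂ z z :=
  TensorProduct.inner_map_map (U.isometry g) (V.isometry g) z z

lemma IsPhysicalState.leftComm {G : Type*} [Group G] [TopologicalSpace G] {U : UnitaryRep G A}
    {U' : UnitaryRep G B} {V : UnitaryRep G K} {ψ : A ⊗[ℂ] (B ⊗[ℂ] K)} (hψ : IsPhysicalState U U' V ψ) :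
    IsPhysicalState U' U V (TensorProduct.leftComm ℂ A B K ψ) :=
  ⟨(norm_leftComm ψ).trans hψ.1, fun g => by rw [← leftComm_tprod, hψ.2]⟩

variable {G : Type*} [Group G] [TopologicalSpace G] [CompactSpace G] [MeasurableSpace G]
  [BorelSpace G] {μ : MeasureTheory.Measure G} [MeasureTheory.IsProbabilityMeasure μ]
  [FiniteDimensional ℂ A] [FiniteDimensional ℂ B] [FiniteDimensional ℂ K]

/-- The normalized vector of a relational state. -/
def CompleteFrame.relVector (R : CompleteFrame G μ B) (Ψ : B ⊗[ℂ] (A ⊗[ℂ] K)) : A ⊗[ℂ] K :=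
  ((√(Module.finrank ℂ B) : ℝ) : ℂ) • braLeft (A ⊗[ℂ] K) R.seed Ψ

lemma CompleteFrame.inner_relVector (R : CompleteFrame G μ B) (U : UnitaryRep G A)
    (V : UnitaryRep G K) {Ψ : B ⊗[ℂ] (A ⊗[ℂ] K)} (hΨ : IsPhysicalState R.toUnitaryRep U V Ψ) :
    inner ℂ (R.relVector Ψ) (R.relVector Ψ) = 1 := by
  have h := R.finrank_mul_inner_braLeft (U.rep.tprod V.rep) (U.inner_tprod V) hΨ.2
  have h1 : inner ℂ Ψ Ψ = (1 : ℂ) := by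
    refine (inner_self_eq_norm_sq_to_K (𝕜 := ℂ) Ψ).trans ?_
    rw [hΨ.1]
    simp
  rw [h1] at h
  rw [← h, relVector]
  refine (inner_smul_left (𝕜 := ℂ) (braLeft (A ⊗[ℂ] K) R.seed Ψ) _ _).trans ?_
  rw [Complex.conj_ofReal]
  refine (congrArg _ (inner_smul_right (𝕜 := ℂ) (braLeft (A ⊗[ℂ] K) R.seed Ψ) _ _)).trans ?_
  rw [← mul_assoc, ← Complex.ofReal_mul, Real.mul_self_sqrt (Nat.cast_nonneg _),
    Complex.ofReal_natCast]

omit [CompactSpace G] [BorelSpace G] [MeasureTheory.IsProbabilityMeasure μ] in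
lemma CompleteFrame.finrank_range_contractRight_relVector (R : CompleteFrame G μ B)
    (U : UnitaryRep G A) (V : UnitaryRep G K) {Ψ : B ⊗[ℂ] (A ⊗[ℂ] K)}
    (hΨ : IsPhysicalState R.toUnitaryRep U V Ψ) :
    Module.finrank ℂ (LinearMap.range (contractRight (R.relVector Ψ))) ≤
      dEff U R.toUnitaryRep V := by
  refine (Submodule.finrank_mono ?_).trans (finrank_range_contractRight_le_dEff U R.toUnitaryRep V
    (TensorProduct.leftComm ℂ B A K Ψ) fun g => ?_)
  · rintro _ ⟨l, rfl⟩
    rw [relVector, contractRight_apply, map_smul, map_smul, ← contractRight_apply,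
      contractRight_braLeft]
    exact Submodule.smul_mem _ _ ⟨_, rfl⟩
  · rw [← leftComm_tprod, hΨ.2]

omit [CompactSpace G] [BorelSpace G] [MeasureTheory.IsProbabilityMeasure μ] in
lemma relState₁_eq_ketBra (R : CompleteFrame G μ B) (ψ : B ⊗[ℂ] (A ⊗[ℂ] K)) :
    relState₁ R ψ = ketBra (R.relVector ψ) :=
  smul_comp_ketBra_comp_adjoint (bra₁ R.seed) ψ (Module.finrank ℂ B)

omit [CompactSpace G] [BorelSpace G] [MeasureTheory.IsProbabilityMeasure μ] in
lemma relState₂_eq_ketBra (R : CompleteFrame G μ B) (ψ : A ⊗[ℂ] (B ⊗[ℂ] K)) :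
    relState₂ R ψ = ketBra (R.relVector (TensorProduct.leftComm ℂ A B K ψ)) := by
  rw [CompleteFrame.relVector, ← bra₂_eq_braLeft_leftComm]
  exact smul_comp_ketBra_comp_adjoint (bra₂ R.seed) ψ (Module.finrank ℂ B)

/-- Entropy bounds for the system in a relational state. -/
lemma CompleteFrame.renyiEntropy_relVector_bounds (R : CompleteFrame G μ B) (U : UnitaryRep G A)
    (V : UnitaryRep G K) {Ψ : B ⊗[ℂ] (A ⊗[ℂ] K)} (hΨ : IsPhysicalState R.toUnitaryRep U V Ψ)
    {α : ℝ} (hα : 0 < α) :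
    0 < dEff U R.toUnitaryRep V ∧ 0 ≤ renyiEntropy α (traceLeft (ketBra (R.relVector Ψ))) ∧
      renyiEntropy α (traceLeft (ketBra (R.relVector Ψ))) ≤
        Real.log (dEff U R.toUnitaryRep V) := by
  obtain ⟨hpos, h0, h1⟩ := renyiEntropy_bounds (isPositive_traceLeft_ketBra (R.relVector Ψ))
    ((trace_traceLeft_ketBra _).trans (R.inner_relVector U V hΨ)) hα
  have hle := (finrank_range_traceLeft_ketBra_le (R.relVector Ψ)).trans
    (R.finrank_range_contractRight_relVector U V hΨ)
  exact ⟨hpos.trans_le hle, h0,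
    h1.trans (Real.log_le_log (by exact_mod_cast hpos) (by exact_mod_cast hle))⟩

end Perspective

end QRF

end

theorem theorem3
    {G : Type*} [Group G] [TopologicalSpace G] [IsTopologicalGroup G] [CompactSpace G]
    [MeasurableSpace G] [BorelSpace G]
    (μ : MeasureTheory.Measure G) [μ.IsHaarMeasure] [MeasureTheory.IsProbabilityMeasure μ]
    {H₁ H₂ K : Type*}
    [NormedAddCommGroup H₁] [InnerProductSpace ℂ H₁] [FiniteDimensional ℂ H₁]
    [NormedAddCommGroup H₂] [InnerProductSpace ℂ H₂] [FiniteDimensional ℂ H₂]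
    [NormedAddCommGroup K] [InnerProductSpace ℂ K] [FiniteDimensional ℂ K]
    (R₁ : QRF.CompleteFrame G μ H₁) (R₂ : QRF.CompleteFrame G μ H₂) (S : QRF.UnitaryRep G K)
    (ψ : TensorProduct ℂ H₁ (TensorProduct ℂ H₂ K))
    (hψ : QRF.IsPhysicalState R₁.toUnitaryRep R₂.toUnitaryRep S ψ)
    (α : ℝ) (hα : 0 < α) :
    Module.finrank ℂ (LinearMap.range (QRF.traceRight (QRF.relState₁ R₁ ψ)))
        ≤ QRF.dEff R₂.toUnitaryRep R₁.toUnitaryRep S ∧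
    Module.finrank ℂ (LinearMap.range (QRF.traceRight (QRF.relState₂ R₂ ψ)))
        ≤ QRF.dEff R₁.toUnitaryRep R₂.toUnitaryRep S ∧
    QRF.entropyDifference α R₁ R₂ ψ ≤
      Real.log (max (QRF.dEff R₁.toUnitaryRep R₂.toUnitaryRep S : ℝ)
        (QRF.dEff R₂.toUnitaryRep R₁.toUnitaryRep S : ℝ)) := by
  have hψ' := hψ.leftComm
  have e₁ := QRF.relState₁_eq_ketBra R₁ ψ
  have e₂ := QRF.relState₂_eq_ketBra R₂ ψ
  obtain ⟨p₁, l₁, u₁⟩ := R₁.renyiEntropy_relVector_bounds R₂.toUnitaryRep S hψ hα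
  obtain ⟨p₂, l₂, u₂⟩ := R₂.renyiEntropy_relVector_bounds R₁.toUnitaryRep S hψ' hα
  refine ⟨?_, ?_, ?_⟩
  · rw [e₁]
    exact (QRF.finrank_range_traceRight_ketBra_le _).trans
      (R₁.finrank_range_contractRight_relVector R₂.toUnitaryRep S hψ)
  · rw [e₂]
    exact (QRF.finrank_range_traceRight_ketBra_le _).trans
      (R₂.finrank_range_contractRight_relVector R₁.toUnitaryRep S hψ')
  · rw [QRF.entropyDifference, e₁, e₂]
    -- Monotonicity of `log` needs positive effective dimensions; a trace-one state has positive
    -- rank, which supplies them.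
    have m₁ := Real.log_le_log (by exact_mod_cast p₁)
      (le_max_right (QRF.dEff R₁.toUnitaryRep R₂.toUnitaryRep S : ℝ)
        (QRF.dEff R₂.toUnitaryRep R₁.toUnitaryRep S : ℝ))
    have m₂ := Real.log_le_log (by exact_mod_cast p₂)
      (le_max_left (QRF.dEff R₁.toUnitaryRep R₂.toUnitaryRep S : ℝ)
        (QRF.dEff R₂.toUnitaryRep R₁.toUnitaryRep S : ℝ))
    rw [abs_le]
    constructor <;> linarith
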